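/- Let $F$ and $F'$ be non-Archimedean local fields with rings of integers $\mathcal{O}$ and $\mathcal{O}'$ and maximal ideals $\wp$ and $\wp'$, and put $\mathcal{O}_2 = \mathcal{O}/\wp^2$ and $\mathcal{O}'_2 = \mathcal{O}'/\wp'^2$. Suppose that the (finite) residue fields $\mathcal{O}/\wp$ and $\mathcal{O}'/\wp'$ have the same cardinality. Then for every natural number $n$ the groups $\mathrm{GL}_n(\mathcal{O}_2)$ and $\mathrm{GL}_n(\mathcal{O}'_2)$ have the same finite number of conjugacy classes. In other words, for each $n$, the number of conjugacy classes of $\mathrm{GL}_n(\mathcal{O}_2)$ depends only on the cardinality of the residue field of $\mathcal{O}$. -/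

import Mathlib

open scoped ValuativeRel

/-- For a non-Archimedean local field `F` with ring of integers `𝒪[F]` and maximal ideal `𝓂[F]`,
this is the ring `𝒪_ℓ = 𝒪 / ℘ ^ ℓ`, the reduction of the ring of integers modulo `℘ ^ ℓ`. -/
abbrev ReducedIntegers (F : Type*) [Field F] [ValuativeRel F] (l : ℕ) : Type _ :=
  𝒪[F] ⧸ (𝓂[F] ^ l)

/-! ### Lifting a matrix over the residue field together with its commutant. -/

section CommutantLift

open Polynomial Matrix Module

universe u

/-! With `k` the residue field, `S = 𝒪 / ℘²` is an extension of `k` by a square-zero ideal `θ(k)`,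
where `θ` is multiplication by a uniformizer. Every element of `GL n S` is `s(A) + θ(X)` for a
set-theoretic section `s`. If each `g` with `g A = B g` lifts to `g'` with `g' s(A) = s(B) g'`, then
`g' + θ(Y)` conjugates `s(A) + θ(X)` to `s(B) + θ(Z)` exactly when `Y A + g X = B Y + Z g`. Nothing
but `k` enters this relation, and `k` is determined by its cardinality.

Such an `s` exists once each `A` has a lift whose commutant surjects onto that of `A`
(`Matrix.exists_lift_commutant`). For this, write `A` as multiplication by `X` on a product of
modules `k[X]/(p ^ e)` and lift each `p` to a monic polynomial. Homomorphisms between the factors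
are multiplications by polynomials, and these lift (`Polynomial.exists_lift_mul_dvd`). -/

theorem Module.Basis.repr_semilinear {S k M V ι : Type*} [CommRing S] [CommRing k]
    [AddCommGroup M] [Module S M] [AddCommGroup V] [Module k V] [Finite ι] {ρ : S →+* k}
    (π : M →ₛₗ[ρ] V) (b : Basis ι S M) (b' : Basis ι k V) (h : ∀ i, π (b i) = b' i)
    (m : M) (i : ι) : b'.repr (π m) i = ρ (b.repr m i) := by
  classical
  have := Fintype.ofFinite ι
  have : π m = ∑ j, ρ (b.repr m j) • b' j := by
    conv_lhs => rw [← b.sum_repr m]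
    simp only [map_sum, map_smulₛₗ, h]
  rw [this, Basis.repr_sum_self]

/-- Lifting a basis along the reduction of a free module over a local ring. -/
theorem Module.Basis.exists_basis_lift {S k M V ι κ : Type*} [CommRing S] [Field k]
    [AddCommGroup M] [Module S M] [AddCommGroup V] [Module k V] [Finite ι] [Finite κ]
    {ρ : S →+* k} [IsLocalHom ρ]
    (π : M →ₛₗ[ρ] V) (b : Basis ι S M) (b' : Basis ι k V) (h : ∀ i, π (b i) = b' i)
    (c' : Basis κ k V) (m : κ → M) (hm : ∀ j, π (m j) = c' j) :
    ∃ c : Basis κ S M, ∀ j, c j = m j := by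
  classical
  have := Fintype.ofFinite ι
  have := Fintype.ofFinite κ
  let e : ι ≃ κ := b'.indexEquiv c'
  have hdet : IsUnit ((b.reindex e).det m) := by
    refine IsUnit.of_map ρ _ ?_
    have : ρ ((b.reindex e).det m) = (b'.reindex e).det c' := by
      rw [Basis.det_apply, Basis.det_apply, RingHom.map_det]
      congr 1
      ext i j
      simp [Basis.toMatrix_apply, ← hm, Basis.repr_semilinear π b b' h]
    rw [this]
    exact (b'.reindex e).isUnit_det c'
  obtain ⟨hli, hsp⟩ := (Basis.is_basis_iff_det _).2 hdet
  exact ⟨Basis.mk hli hsp.ge, fun j => Basis.mk_apply hli hsp.ge j⟩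

/-- Suppose the `k`-space `V` is the reduction of the free `S`-module `M`, and the endomorphism `x`
of `M` reduces to the endomorphism of `V` with matrix `A`. If every endomorphism commuting with the
latter lifts to one commuting with `x`, then `A` has a lift whose commutant surjects onto that
of `A`. -/
theorem Matrix.exists_lift_commutant_of_module {S k M V ι n : Type*} [CommRing S] [Field k]
    [AddCommGroup M] [Module S M] [AddCommGroup V] [Module k V] [Finite ι]
    [Fintype n] [DecidableEq n]
    {ρ : S →+* k} [IsLocalHom ρ]
    (π : M →ₛₗ[ρ] V) (hπ : Function.Surjective π)
    (b : Basis ι S M) (b' : Basis ι k V) (h : ∀ i, π (b i) = b' i)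
    (x : M →ₗ[S] M) (x' : V →ₗ[k] V) (hx : ∀ m, π (x m) = x' (π m))
    (hlift : ∀ t' : V →ₗ[k] V, Commute x' t' →
      ∃ t : M →ₗ[S] M, Commute x t ∧ ∀ m, π (t m) = t' (π m))
    (A : Matrix n n k) (φ : (n → k) ≃ₗ[k] V) (hφ : ∀ v, φ (A *ᵥ v) = x' (φ v)) :
    ∃ A' : Matrix n n S, A'.map ρ = A ∧
      ∀ B, Commute A B → ∃ B' : Matrix n n S, B'.map ρ = B ∧ Commute A' B' := by
  let c' : Basis n k V := (Pi.basisFun k n).map φ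
  choose m hm using fun j => hπ (c' j)
  obtain ⟨c, hc⟩ := Basis.exists_basis_lift π b b' h c' m hm
  have hcm : ∀ j, π (c j) = c' j := fun j => by rw [hc, hm]
  have key : ∀ (t : M →ₗ[S] M) (t' : V →ₗ[k] V) (B : Matrix n n k), (∀ m, π (t m) = t' (π m)) →
      (∀ v, φ (B *ᵥ v) = t' (φ v)) → (LinearMap.toMatrix c c t).map ρ = B := by
    intro t t' B ht hB
    ext i j
    rw [map_apply, LinearMap.toMatrix_apply, ← Basis.repr_semilinear π c c' hcm, ht, hcm]
    simp [c', ← hB]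
  refine ⟨LinearMap.toMatrix c c x, key x x' A hx hφ, fun B hB => ?_⟩
  have hmv : ∀ v, A *ᵥ (B *ᵥ v) = B *ᵥ (A *ᵥ v) := fun v => by
    rw [mulVec_mulVec, mulVec_mulVec, hB.eq]
  have hφ' : ∀ w, φ.symm (x' w) = A *ᵥ φ.symm w := fun w => by
    rw [LinearEquiv.symm_apply_eq, hφ, LinearEquiv.apply_symm_apply]
  obtain ⟨t, hxt, ht⟩ := hlift (φ.toLinearMap ∘ₗ B.mulVecLin ∘ₗ φ.symm.toLinearMap) (by
    ext w
    simp [← hφ, hφ', hmv])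
  refine ⟨LinearMap.toMatrix c c t, key t _ B ht (by simp), ?_⟩
  rw [Commute, SemiconjBy, ← LinearMap.toMatrix_mul, ← LinearMap.toMatrix_mul, hxt.eq]

theorem AdjoinRoot.exists_linearMap_of_dvd {R : Type*} [CommRing R] {f g h : R[X]}
    (hd : g ∣ f * h) :
    ∃ t : AdjoinRoot f →ₗ[R] AdjoinRoot g, ∀ p, t (AdjoinRoot.mk f p) = AdjoinRoot.mk g (p * h) := by
  have hle : Ideal.span {f} ≤ Submodule.comap (LinearMap.mulRight R[X] h) (Ideal.span {g}) := by
    rw [Ideal.span_singleton_le_iff_mem]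
    exact Ideal.mem_span_singleton.2 hd
  exact ⟨(Submodule.mapQ (Ideal.span {f}) (Ideal.span {g})
    (LinearMap.mulRight R[X] h) hle).restrictScalars R, fun p => rfl⟩

/-- The lift is a function of the polynomial, so that equal irreducible factors receive equal lifts.
-/
theorem Polynomial.exists_monic_lift_fun {S k : Type*} [CommRing S] [Field k] (ρ : S →+* k)
    (hρ : Function.Surjective ρ) :
    ∃ P : k[X] → S[X], ∀ p, p.Monic → (P p).map ρ = p ∧ (P p).Monic := by
  classical
  have : ∀ p : k[X], ∃ q : S[X], p.Monic → q.map ρ = p ∧ q.Monic := by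
    intro p
    by_cases hp : p.Monic
    · obtain ⟨q, hq, -, hm⟩ := lifts_and_natDegree_eq_and_monic
        ((mem_lifts p).2 (map_surjective ρ hρ p)) hp
      exact ⟨q, fun _ => ⟨hq, hm⟩⟩
    · exact ⟨0, fun h => (hp h).elim⟩
  exact ⟨fun p => (this p).choose, fun p => (this p).choose_spec⟩

/-- Multiplication by `g` is a map `k[X]/(p ^ a) → k[X]/(q ^ b)`, to be lifted. If `p ≠ q`,
coprimality makes it zero. If `p = q`, any lift of `g` works when `b ≤ a`; otherwise `p ^ (b - a)`
divides `g`, and the quotient is lifted. -/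
theorem Polynomial.exists_lift_mul_dvd {S k : Type*} [CommRing S] [Field k] (ρ : S →+* k)
    (hρ : Function.Surjective ρ) (P : k[X] → S[X])
    (hP : ∀ p, p.Monic → (P p).map ρ = p ∧ (P p).Monic)
    {p q : k[X]} (hp : Irreducible p) (hq : Irreducible q) (hpm : p.Monic) (hqm : q.Monic)
    (a b : ℕ) (g : k[X]) (hd : q ^ b ∣ p ^ a * g) :
    ∃ G : S[X], q ^ b ∣ G.map ρ - g ∧ P q ^ b ∣ P p ^ a * G := by
  by_cases hpq : p = q
  · subst hpq
    obtain hab | hab := le_total b a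
    · obtain ⟨G, hG⟩ := map_surjective ρ hρ g
      exact ⟨G, by simp [hG], (pow_dvd_pow _ hab).mul_right _⟩
    · obtain ⟨c, rfl⟩ := Nat.exists_eq_add_of_le hab
      rw [pow_add] at hd
      obtain ⟨h, rfl⟩ := (mul_dvd_mul_iff_left (pow_ne_zero a hp.ne_zero)).1 hd
      obtain ⟨H, hH⟩ := map_surjective ρ hρ h
      refine ⟨P p ^ c * H, by simp [hH, (hP p hpm).1], ?_⟩
      rw [pow_add]
      exact mul_dvd_mul_left _ (dvd_mul_right _ _)
  · have hcop : IsCoprime (q ^ b) (p ^ a) := by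
      refine IsCoprime.pow ((hq.coprime_iff_not_dvd).2 fun h => hpq ?_)
      exact (eq_of_monic_of_associated hqm hpm
        ((hq.dvd_irreducible_iff_associated hp).1 h)).symm
    exact ⟨0, by simpa using hcop.dvd_of_dvd_mul_left hd, by simp⟩

/-- The rational canonical form: a matrix over a field acts like multiplication by the root on
a product of quotients of the polynomial ring by powers of irreducible monic polynomials. -/
theorem Matrix.exists_equiv_pi_adjoinRoot {k : Type u} {n : ℕ} [Field k]
    (A : Matrix (Fin n) (Fin n) k) :
    ∃ (ι : Type u) (_ : Fintype ι) (p : ι → k[X]) (e : ι → ℕ)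
      (φ : (Fin n → k) ≃ₗ[k] ∀ i, AdjoinRoot (p i ^ e i)),
      (∀ i, Irreducible (p i) ∧ (p i).Monic) ∧
      ∀ v i, φ (A *ᵥ v) i = AdjoinRoot.root (p i ^ e i) * φ v i := by
  classical
  obtain ⟨ι, hι, p, hp, e, ⟨ψ⟩⟩ := equiv_directSum_of_isTorsion (R := k[X])
    (M := AEval' A.mulVecLin) (AEval.isTorsion_of_finiteDimensional k _ _)
  -- Normalizing makes associated irreducible factors equal, as the case split on `p = q` requires.
  have hspan : ∀ i, Ideal.span {p i ^ e i} = Ideal.span {normalize (p i) ^ e i} := fun i =>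
    Ideal.span_singleton_eq_span_singleton.2 ((normalize_associated (p i)).symm.pow_pow)
  let θ : ∀ i, (k[X] ⧸ Ideal.span {p i ^ e i}) ≃ₗ[k] AdjoinRoot (normalize (p i) ^ e i) :=
    fun i => (Submodule.quotEquivOfEq _ _ (hspan i)).restrictScalars k
  have hθ : ∀ i v, θ i ((X : k[X]) • v) = AdjoinRoot.root _ * θ i v := by
    intro i v
    obtain ⟨v, rfl⟩ := Submodule.mkQ_surjective _ v
    rfl
  refine ⟨ι, hι, fun i => normalize (p i), e,
    (AEval'.of A.mulVecLin).trans ((ψ.trans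
      (DirectSum.linearEquivFunOnFintype k[X] ι _)).restrictScalars k) |>.trans
        (LinearEquiv.piCongrRight θ), fun i => ⟨?_, ?_⟩, fun v i => ?_⟩
  · exact (normalize_associated (p i)).symm.irreducible (hp i)
  · exact monic_normalize (hp i).ne_zero
  · have : AEval'.of A.mulVecLin (A *ᵥ v) = (X : k[X]) • AEval'.of A.mulVecLin v :=
      (AEval'.X_smul_of _ _).symm
    simp [this, hθ]

theorem AdjoinRoot.exists_basis_pow {R : Type*} [CommRing R] {f : R[X]} (hf : f.Monic) {d : ℕ}
    (hd : f.natDegree = d) :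
    ∃ b : Basis (Fin d) R (AdjoinRoot f), ∀ i, b i = AdjoinRoot.root f ^ (i : ℕ) := by
  subst hd
  exact ⟨(AdjoinRoot.powerBasis' hf).basis, (AdjoinRoot.powerBasis' hf).basis_eq_pow⟩

theorem AdjoinRoot.map_mk {R S : Type*} [CommRing R] [CommRing S] (ρ : R →+* S) (f : R[X])
    (g : S[X]) (h : g ∣ f.map ρ) (p : R[X]) :
    AdjoinRoot.map ρ f g h (AdjoinRoot.mk f p) = AdjoinRoot.mk g (p.map ρ) := by
  rw [AdjoinRoot.map, AdjoinRoot.lift_mk, ← eval₂_map, ← AdjoinRoot.algebraMap_eq, ← aeval_def,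
    AdjoinRoot.aeval_eq]

/-- Commuting with the roots makes `t` linear over `k[X]`, hence determined by the images of the
generators. -/
theorem AdjoinRoot.linearMap_single_mk {k ι : Type*} [CommRing k] [DecidableEq ι] {f : ι → k[X]}
    (t : (∀ i, AdjoinRoot (f i)) →ₗ[k] ∀ i, AdjoinRoot (f i))
    (ht : ∀ v, t (fun i => AdjoinRoot.root (f i) * v i) = fun i => AdjoinRoot.root (f i) * t v i)
    (i j : ι) (p : k[X]) :
    t (Pi.single i (AdjoinRoot.mk (f i) p)) j = AdjoinRoot.mk (f j) p * t (Pi.single i 1) j := by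
  induction p using Polynomial.induction_on with
  | C a =>
    have : (Pi.single i (AdjoinRoot.mk (f i) (C a)) : ∀ i, AdjoinRoot (f i)) =
        a • Pi.single i 1 := by
      rw [← Pi.single_smul, Algebra.smul_def, mul_one]; rfl
    rw [this, map_smul, Pi.smul_apply, Algebra.smul_def]; rfl
  | add p q hp hq => rw [map_add, Pi.single_add, map_add, Pi.add_apply, hp, hq, map_add, add_mul]
  | monomial n a ih =>
    have h1 : ∀ j, AdjoinRoot.mk (f j) (C a * X ^ (n + 1)) =
        AdjoinRoot.root (f j) * AdjoinRoot.mk (f j) (C a * X ^ n) := fun j => by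
      rw [AdjoinRoot.root, ← map_mul]
      congr 1
      ring
    have h2 : (Pi.single i (AdjoinRoot.mk (f i) (C a * X ^ (n + 1))) : ∀ i, AdjoinRoot (f i)) =
        fun l => AdjoinRoot.root (f l) *
          (Pi.single i (AdjoinRoot.mk (f i) (C a * X ^ n)) : ∀ i, AdjoinRoot (f i)) l := by
      ext l
      by_cases h : l = i
      · subst h; simp only [Pi.single_eq_same, h1]
      · simp only [Pi.single_eq_of_ne h, mul_zero]
    rw [h2, ht, h1, mul_assoc, ← ih]

/-- Every square matrix over the residue field of a local ring has a lift such that every matrix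
commuting with the former lifts to a matrix commuting with the latter. -/
theorem Matrix.exists_lift_commutant {S k : Type*} [CommRing S] [Field k] {ρ : S →+* k}
    [IsLocalHom ρ] (hρ : Function.Surjective ρ) {n : ℕ} (A : Matrix (Fin n) (Fin n) k) :
    ∃ A' : Matrix (Fin n) (Fin n) S, A'.map ρ = A ∧
      ∀ B, Commute A B → ∃ B' : Matrix (Fin n) (Fin n) S, B'.map ρ = B ∧ Commute A' B' := by
  classical
  obtain ⟨ι, _, p, e, φ, hp, hφ⟩ := A.exists_equiv_pi_adjoinRoot
  obtain ⟨P, hP⟩ := exists_monic_lift_fun ρ hρ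
  have hPm : ∀ i, (P (p i) ^ e i).map ρ = p i ^ e i := fun i => by
    rw [Polynomial.map_pow, (hP _ (hp i).2).1]
  have hFm : ∀ i, (P (p i) ^ e i).Monic := fun i => (hP _ (hp i).2).2.pow _
  have hfm : ∀ i, (p i ^ e i).Monic := fun i => (hp i).2.pow _
  have hdeg : ∀ i, (p i ^ e i).natDegree = (P (p i) ^ e i).natDegree := fun i => by
    rw [← hPm i, (hFm i).natDegree_map]
  let r : ∀ i, AdjoinRoot (P (p i) ^ e i) →+* AdjoinRoot (p i ^ e i) := fun i =>
    AdjoinRoot.map ρ _ _ (hPm i).symm.dvd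
  have hr : ∀ i q, r i (AdjoinRoot.mk _ q) = AdjoinRoot.mk _ (q.map ρ) := fun i q =>
    AdjoinRoot.map_mk ρ _ _ _ q
  have hroot : ∀ i, r i (AdjoinRoot.root _) = AdjoinRoot.root _ := fun i => by
    rw [AdjoinRoot.root, hr, map_X]; rfl
  let π : (∀ i, AdjoinRoot (P (p i) ^ e i)) →ₛₗ[ρ] ∀ i, AdjoinRoot (p i ^ e i) :=
    { toFun := fun m i => r i (m i)
      map_add' := fun a b => funext fun i => map_add (r i) _ _
      map_smul' := fun s m => funext fun i => by
        rw [Pi.smul_apply, Pi.smul_apply, Algebra.smul_def, Algebra.smul_def, map_mul,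
          AdjoinRoot.algebraMap_eq, AdjoinRoot.algebraMap_eq, AdjoinRoot.map_of] }
  have hπ_apply : ∀ m i, π m i = r i (m i) := fun _ _ => rfl
  have hπ : Function.Surjective π := fun v => by
    have : ∀ i, ∃ m, r i m = v i := fun i => by
      obtain ⟨q, hq⟩ := AdjoinRoot.mk_surjective (v i)
      obtain ⟨Q, rfl⟩ := map_surjective ρ hρ q
      exact ⟨AdjoinRoot.mk _ Q, by rw [hr, hq]⟩
    choose m hm using this
    exact ⟨m, funext hm⟩
  choose β hβ using fun i => AdjoinRoot.exists_basis_pow (hFm i) (hdeg i).symm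
  choose β' hβ' using fun i => AdjoinRoot.exists_basis_pow (hfm i) rfl
  have hb : ∀ a, π (Pi.basis β a) = Pi.basis β' a := by
    rintro ⟨i, a⟩
    ext j
    rw [hπ_apply, Pi.basis_apply, Pi.basis_apply]
    by_cases h : j = i
    · subst h
      rw [Pi.single_eq_same, Pi.single_eq_same, hβ, hβ', map_pow, hroot]
    · rw [Pi.single_eq_of_ne h, Pi.single_eq_of_ne h, map_zero]
  refine Matrix.exists_lift_commutant_of_module π hπ (Pi.basis β) (Pi.basis β') hb
    (LinearMap.mulLeft S fun i => AdjoinRoot.root _)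
    (LinearMap.mulLeft k fun i => AdjoinRoot.root _) ?_ ?_ A φ (fun v => funext (hφ v))
  · intro m
    ext i
    simp only [hπ_apply, LinearMap.mulLeft_apply, Pi.mul_apply, map_mul, hroot]
  · intro t' ht'
    have hsingle := AdjoinRoot.linearMap_single_mk t' fun v => (LinearMap.congr_fun ht'.eq v).symm
    choose g hg using fun i j => AdjoinRoot.mk_surjective (t' (Pi.single i 1) j)
    -- The generator of the `i`-th factor is killed by `p i ^ e i`, hence so is its image.
    have hd : ∀ i j, p j ^ e j ∣ p i ^ e i * g i j := fun i j => by
      rw [← AdjoinRoot.mk_eq_zero, map_mul, hg, ← hsingle, AdjoinRoot.mk_self, Pi.single_zero,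
        map_zero, Pi.zero_apply]
    choose G hG hGd using fun i j => exists_lift_mul_dvd ρ hρ P hP (hp i).1 (hp j).1 (hp i).2
      (hp j).2 (e i) (e j) (g i j) (hd i j)
    choose T hT using fun i j => AdjoinRoot.exists_linearMap_of_dvd (hGd i j)
    have hrT : ∀ i j m, r j (T i j m) = t' (Pi.single i (r i m)) j := fun i j m => by
      obtain ⟨q, rfl⟩ := AdjoinRoot.mk_surjective m
      rw [hT, hr, hr, hsingle, ← hg, ← map_mul, Polynomial.map_mul, AdjoinRoot.mk_eq_mk, ← mul_sub]
      exact (hG i j).mul_left _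
    have hTroot : ∀ i j m, T i j (AdjoinRoot.root _ * m) = AdjoinRoot.root _ * T i j m :=
      fun i j m => by
        obtain ⟨q, rfl⟩ := AdjoinRoot.mk_surjective m
        rw [AdjoinRoot.root, AdjoinRoot.root, ← map_mul, hT, hT, ← map_mul, mul_assoc]
    refine ⟨LinearMap.pi fun j => ∑ i, T i j ∘ₗ LinearMap.proj i, ?_, fun m => ?_⟩
    · refine LinearMap.ext fun m => funext fun j => ?_
      simp [hTroot, Finset.mul_sum]
    · ext j
      have : π m = ∑ i, Pi.single i (r i (m i)) := (Finset.univ_sum_single (π m)).symm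
      rw [this, hπ_apply]
      simp [hrT]

end CommutantLift

/-! ### Conjugacy in `GL n` over an extension of `k` by `k`. -/

section ConjugacyClasses

open Matrix

theorem Matrix.isUnit_of_isUnit_map {S k : Type*} [CommRing S] [CommRing k] (ρ : S →+* k)
    [IsLocalHom ρ] {n : Type*} [Fintype n] [DecidableEq n] {U : Matrix n n S}
    (h : IsUnit (U.map ρ)) : IsUnit U := by
  rw [isUnit_iff_isUnit_det] at h ⊢
  refine IsUnit.of_map ρ _ ?_
  rwa [RingHom.map_det]

/-- A choice of lifts of matrices such that every conjugation lifts. -/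
theorem Matrix.exists_section_lifting_conj {S k : Type*} [CommRing S] [Field k] {ρ : S →+* k}
    [IsLocalHom ρ] (hρ : Function.Surjective ρ) (n : ℕ) :
    ∃ s : Matrix (Fin n) (Fin n) k → Matrix (Fin n) (Fin n) S, (∀ A, (s A).map ρ = A) ∧
      ∀ A A' g, IsUnit g → g * A = A' * g →
        ∃ g' : Matrix (Fin n) (Fin n) S, g'.map ρ = g ∧ g' * s A = s A' * g' := by
  classical
  choose l hl hlc using fun A : Matrix (Fin n) (Fin n) k => A.exists_lift_commutant hρ
  have hGL : ∀ g : (Matrix (Fin n) (Fin n) k)ˣ, ∃ u : (Matrix (Fin n) (Fin n) S)ˣ,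
      (u : Matrix (Fin n) (Fin n) S).map ρ = g := fun g =>
    ⟨(isUnit_of_isUnit_map ρ (U := l g) (by rw [hl]; exact g.isUnit)).unit, hl g⟩
  choose L hL using hGL
  have hLinv : ∀ g : (Matrix (Fin n) (Fin n) k)ˣ,
      ((L g)⁻¹ : (Matrix (Fin n) (Fin n) S)ˣ).1.map ρ = (g⁻¹ : (Matrix (Fin n) (Fin n) k)ˣ) := by
    intro g
    refine (Units.inv_eq_of_mul_eq_one_right ?_).symm
    rw [← hL, ← Matrix.map_mul, Units.mul_inv, Matrix.map_one _ (map_zero _) (map_one _)]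
  -- The good lift is chosen at one representative per class and transported to the rest of the
  -- class by lifts of conjugating matrices.
  let rep : Matrix (Fin n) (Fin n) k → Matrix (Fin n) (Fin n) k := fun A =>
    (ConjClasses.mk A).exists_rep.choose
  have hrep : ∀ A, ∃ c : (Matrix (Fin n) (Fin n) k)ˣ, SemiconjBy (c : Matrix _ _ k) (rep A) A :=
    fun A => ConjClasses.mk_eq_mk_iff_isConj.1 (ConjClasses.mk A).exists_rep.choose_spec
  choose c hc using hrep
  have hrep_eq : ∀ A A', IsConj A A' → rep A = rep A' := fun A A' h => by
    simp only [rep, ConjClasses.mk_eq_mk_iff_isConj.2 h]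
  refine ⟨fun A => L (c A) * l (rep A) * ((L (c A))⁻¹ : (Matrix (Fin n) (Fin n) S)ˣ),
    fun A => ?_, ?_⟩
  · rw [Matrix.map_mul, Matrix.map_mul, hL, hLinv, hl, (hc A).eq, Units.mul_inv_cancel_right]
  · rintro A A' _ ⟨g, rfl⟩ hg
    have hr := hrep_eq A A' ⟨g, hg⟩
    have hA' := hc A'
    rw [← hr] at hA'
    have h1 : SemiconjBy (((c A')⁻¹ : (Matrix (Fin n) (Fin n) k)ˣ) : Matrix (Fin n) (Fin n) k)
        A' (rep A) := SemiconjBy.units_inv_symm_left hA'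
    have h2 : SemiconjBy (g : Matrix (Fin n) (Fin n) k) A A' := hg
    -- Moved back to the representative, `g` becomes an element of its commutant, which lifts.
    have hz : Commute (rep A) (((c A')⁻¹ : (Matrix (Fin n) (Fin n) k)ˣ).1 * g.1 * (c A).1) :=
      Commute.symm ((h1.mul_left h2).mul_left (hc A))
    obtain ⟨z, hz, hzc⟩ := hlc _ _ hz
    refine ⟨L (c A') * z * ((L (c A))⁻¹ : (Matrix (Fin n) (Fin n) S)ˣ), ?_, ?_⟩
    · rw [Matrix.map_mul, Matrix.map_mul, hL, hLinv, hz]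
      simp [mul_assoc]
    · beta_reduce
      rw [← hr]
      simp only [mul_assoc, Units.inv_mul_cancel_left]
      rw [← mul_assoc z, ← hzc.eq, mul_assoc]

/-- Let `S` be an extension of the field `k` by an ideal that is identified with `k`. The elements
of `GL n S` correspond to pairs of an element of `GL n k` and a matrix over `k`, in such a way that
conjugacy is described in terms of `k` alone. -/
theorem Matrix.GeneralLinearGroup.exists_equiv_prod {S k : Type*} [CommRing S] [Field k]
    {ρ : S →+* k} [IsLocalHom ρ] (hρ : Function.Surjective ρ) (θ : k →+ S)
    (hθ : Function.Injective θ) (hθρ : ∀ s, ρ s = 0 ↔ s ∈ Set.range θ)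
    (hθmul : ∀ s a, θ (ρ s * a) = s * θ a) (n : ℕ) :
    ∃ Ψ : GL (Fin n) S ≃ GL (Fin n) k × Matrix (Fin n) (Fin n) k, ∀ U V, IsConj U V ↔
      ∃ (g : GL (Fin n) k) (Y : Matrix (Fin n) (Fin n) k), g * (Ψ U).1 = (Ψ V).1 * g ∧
        Y * (Ψ U).1.1 + g * (Ψ U).2 = (Ψ V).1 * Y + (Ψ V).2 * g := by
  classical
  obtain ⟨s, hs, hsc⟩ := exists_section_lifting_conj hρ n
  have hinj : Function.Injective fun X : Matrix (Fin n) (Fin n) k => X.map θ :=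
    Matrix.map_injective hθ
  have hθ0 : ∀ X : Matrix (Fin n) (Fin n) k, (X.map θ).map ρ = 0 := fun X => by
    ext i j
    exact (hθρ _).2 ⟨X i j, rfl⟩
  have hadd : ∀ X Y : Matrix (Fin n) (Fin n) S, (X + Y).map ρ = X.map ρ + Y.map ρ :=
    fun X Y => Matrix.map_add ρ (map_add ρ) X Y
  have hex : ∀ X : Matrix (Fin n) (Fin n) S, X.map ρ = 0 → ∃ Y, X = Matrix.map Y θ := by
    intro X hX
    choose Y hY using fun i j => (hθρ (X i j)).1 (congrFun (congrFun hX i) j)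
    exact ⟨of Y, by ext i j; exact (hY i j).symm⟩
  have hmulL : ∀ (U : Matrix (Fin n) (Fin n) S) (X : Matrix (Fin n) (Fin n) k),
      U * X.map θ = (U.map ρ * X).map θ := fun U X => by
    ext i j
    simp [Matrix.mul_apply, hθmul]
  have hmulR : ∀ (U : Matrix (Fin n) (Fin n) S) (X : Matrix (Fin n) (Fin n) k),
      X.map θ * U = (X * U.map ρ).map θ := fun U X => by
    ext i j
    simp [Matrix.mul_apply, mul_comm _ (ρ _), hθmul, mul_comm _ (U _ _)]
  let f : GL (Fin n) k × Matrix (Fin n) (Fin n) k → GL (Fin n) S := fun x =>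
    (isUnit_of_isUnit_map ρ (U := s x.1 + x.2.map θ) (by
      rw [hadd, hs, hθ0, add_zero]; exact x.1.isUnit)).unit
  have hf : ∀ x, (f x : Matrix (Fin n) (Fin n) S) = s x.1 + x.2.map θ := fun x => rfl
  have hfρ : ∀ x, (f x : Matrix (Fin n) (Fin n) S).map ρ = x.1 := fun x => by
    rw [hf, hadd, hs, hθ0, add_zero]
  have hbij : Function.Bijective f := by
    constructor
    · rintro ⟨A, X⟩ ⟨B, Y⟩ h
      obtain rfl : A = B := Units.ext (by rw [← hfρ (A, X), h, hfρ])
      have h' := congrArg Units.val h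
      rw [hf, hf] at h'
      exact Prod.ext rfl (hinj (add_left_cancel h'))
    · intro U
      let A : GL (Fin n) k := GeneralLinearGroup.map ρ U
      have hA : (A : Matrix (Fin n) (Fin n) k) = (U : Matrix (Fin n) (Fin n) S).map ρ := rfl
      obtain ⟨X, hX⟩ := hex (U - s A) (by
        rw [Matrix.map_sub ρ (map_sub ρ), hs, hA, sub_self])
      exact ⟨(A, X), Units.ext (by rw [hf, ← hX, add_sub_cancel])⟩
  refine ⟨(Equiv.ofBijective f hbij).symm, fun U V => ?_⟩
  obtain ⟨⟨A, X⟩, rfl⟩ := hbij.2 U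
  obtain ⟨⟨B, Z⟩, rfl⟩ := hbij.2 V
  simp only [Equiv.ofBijective_symm_apply_apply]
  -- In the products below `θ(Y) θ(X)` vanishes, since multiplying by `θ(Y)` only sees the other
  -- factor modulo the ideal.
  have key : ∀ (g : GL (Fin n) k) (g' : Matrix (Fin n) (Fin n) S) (Y : Matrix (Fin n) (Fin n) k),
      g'.map ρ = g → g' * s A = s B * g' →
      ((g' + Y.map θ) * (f (A, X)) = f (B, Z) * (g' + Y.map θ) ↔
        Y * A.1 + g * X = B * Y + Z * g) := by
    intro g g' Y hg hgs
    have h1 : (g' + Y.map θ) * (f (A, X)) = g' * s A + (Y * A.1 + g * X).map θ := by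
      rw [add_mul, hmulR, hfρ, hf, mul_add, hmulL, hg, Matrix.map_add θ (map_add θ)]
      abel
    have h2 : f (B, Z) * (g' + Y.map θ) = s B * g' + (B * Y + Z * g).map θ := by
      rw [mul_add, hmulL, hfρ, hf, add_mul, hmulR, hg, Matrix.map_add θ (map_add θ)]
      abel
    rw [h1, h2, hgs, add_right_inj, hinj.eq_iff]
  constructor
  · intro h
    obtain ⟨u, hu⟩ := isConj_iff.1 h
    rw [mul_inv_eq_iff_eq_mul] at hu
    let g : GL (Fin n) k := GeneralLinearGroup.map ρ u
    have hg : (g : Matrix (Fin n) (Fin n) k) = (u : Matrix (Fin n) (Fin n) S).map ρ := rfl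
    have hu' : (u : Matrix (Fin n) (Fin n) S) * f (A, X) = f (B, Z) * u := congrArg Units.val hu
    have hgA : (g : Matrix (Fin n) (Fin n) k) * A = B * g := by
      rw [hg, ← hfρ (A, X), ← hfρ (B, Z), ← Matrix.map_mul, hu', Matrix.map_mul]
    obtain ⟨g', hg', hgs⟩ := hsc A B g g.isUnit hgA
    obtain ⟨Y, hY⟩ := hex (u - g') (by
      rw [Matrix.map_sub ρ (map_sub ρ), hg', hg, sub_self])
    refine ⟨g, Y, Units.ext hgA, (key g g' Y hg' hgs).1 ?_⟩
    rw [← hY, add_sub_cancel, hu']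
  · rintro ⟨g, Y, hgA, hY⟩
    obtain ⟨g', hg', hgs⟩ := hsc A B g g.isUnit (congrArg Units.val hgA)
    have hunit : IsUnit (g' + Y.map θ) := isUnit_of_isUnit_map ρ (by
      rw [hadd, hg', hθ0, add_zero]; exact g.isUnit)
    refine isConj_iff.2 ⟨hunit.unit, ?_⟩
    rw [mul_inv_eq_iff_eq_mul]
    exact Units.ext ((key g g' Y hg' hgs).2 hY)

/-- Two extensions of a field `k` by an ideal that is identified with `k` have general linear
groups with equally many conjugacy classes. -/
theorem Matrix.GeneralLinearGroup.nonempty_conjClasses_equiv {S S' k : Type*} [CommRing S]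
    [CommRing S'] [Field k]
    {ρ : S →+* k} [IsLocalHom ρ] (hρ : Function.Surjective ρ) (θ : k →+ S)
    (hθ : Function.Injective θ) (hθρ : ∀ s, ρ s = 0 ↔ s ∈ Set.range θ)
    (hθmul : ∀ s a, θ (ρ s * a) = s * θ a)
    {ρ' : S' →+* k} [IsLocalHom ρ'] (hρ' : Function.Surjective ρ') (θ' : k →+ S')
    (hθ' : Function.Injective θ') (hθρ' : ∀ s, ρ' s = 0 ↔ s ∈ Set.range θ')
    (hθmul' : ∀ s a, θ' (ρ' s * a) = s * θ' a) (n : ℕ) :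
    Nonempty (ConjClasses (GL (Fin n) S) ≃ ConjClasses (GL (Fin n) S')) := by
  obtain ⟨Ψ, hΨ⟩ := exists_equiv_prod hρ θ hθ hθρ hθmul n
  obtain ⟨Ψ', hΨ'⟩ := exists_equiv_prod hρ' θ' hθ' hθρ' hθmul' n
  refine ⟨Quotient.congr (Ψ.trans Ψ'.symm) fun U V => ?_⟩
  change IsConj U V ↔ IsConj _ _
  rw [hΨ, hΨ']
  simp

/-- For a discrete valuation ring `R` with maximal ideal `m`, the ring `R ⧸ m ^ 2` is an extension
of the residue field by an ideal that is identified with the residue field. -/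
theorem IsDiscreteValuationRing.exists_quotient_maximalIdeal_sq {R : Type*} [CommRing R]
    [IsDomain R] [IsDiscreteValuationRing R] :
    ∃ (ρ : R ⧸ IsLocalRing.maximalIdeal R ^ 2 →+* IsLocalRing.ResidueField R)
      (θ : IsLocalRing.ResidueField R →+ R ⧸ IsLocalRing.maximalIdeal R ^ 2),
      IsLocalHom ρ ∧ Function.Surjective ρ ∧ Function.Injective θ ∧
      (∀ s, ρ s = 0 ↔ s ∈ Set.range θ) ∧ ∀ s a, θ (ρ s * a) = s * θ a := by
  obtain ⟨ϖ, hϖ⟩ := IsDiscreteValuationRing.exists_irreducible R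
  have hm : IsLocalRing.maximalIdeal R = Ideal.span {ϖ} := hϖ.maximalIdeal_eq
  have hmem : ∀ x, x ∈ IsLocalRing.maximalIdeal R ↔ ϖ ∣ x := fun x => by
    rw [hm, Ideal.mem_span_singleton]
  have hm2 : IsLocalRing.maximalIdeal R ^ 2 = Ideal.span {ϖ ^ 2} := by
    rw [hm, Ideal.span_singleton_pow]
  let ρ : R ⧸ IsLocalRing.maximalIdeal R ^ 2 →+* IsLocalRing.ResidueField R :=
    Ideal.Quotient.factor (Ideal.pow_le_self two_ne_zero)
  have hρmk : ∀ r, ρ (Ideal.Quotient.mk _ r) = IsLocalRing.residue R r := fun r => rfl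
  have hle : IsLocalRing.maximalIdeal R ≤ Submodule.comap (LinearMap.mulLeft R ϖ)
      (IsLocalRing.maximalIdeal R ^ 2) := fun x hx => by
    rw [Submodule.mem_comap, LinearMap.mulLeft_apply, pow_two]
    exact Ideal.mul_mem_mul (hm ▸ Ideal.mem_span_singleton_self ϖ) hx
  -- Multiplication by `ϖ` sends `m` into `m ^ 2`, so it descends to `R ⧸ m → R ⧸ m ^ 2`.
  let θ : IsLocalRing.ResidueField R →+ R ⧸ IsLocalRing.maximalIdeal R ^ 2 :=
    (Submodule.mapQ (IsLocalRing.maximalIdeal R) _ (LinearMap.mulLeft R ϖ) hle).toAddMonoidHom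
  have hθmk : ∀ r, θ (IsLocalRing.residue R r) = Ideal.Quotient.mk _ (ϖ * r) := fun r => rfl
  refine ⟨ρ, θ, ⟨fun s hs => ?_⟩, Ideal.Quotient.factor_surjective _, ?_, fun s => ?_,
    fun s a => ?_⟩
  · obtain ⟨r, rfl⟩ := Ideal.Quotient.mk_surjective s
    rw [hρmk] at hs
    exact (IsUnit.of_map (IsLocalRing.residue R) r hs).map _
  · rw [injective_iff_map_eq_zero]
    intro a ha
    obtain ⟨r, rfl⟩ := IsLocalRing.residue_surjective a
    rw [hθmk, Ideal.Quotient.eq_zero_iff_mem, hm2, Ideal.mem_span_singleton, pow_two,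
      mul_dvd_mul_iff_left hϖ.ne_zero] at ha
    rw [IsLocalRing.residue_eq_zero_iff, hmem]
    exact ha
  · obtain ⟨r, rfl⟩ := Ideal.Quotient.mk_surjective s
    rw [hρmk, IsLocalRing.residue_eq_zero_iff, hmem]
    constructor
    · rintro ⟨t, rfl⟩
      exact ⟨IsLocalRing.residue R t, hθmk t⟩
    · rintro ⟨a, ha⟩
      obtain ⟨t, rfl⟩ := IsLocalRing.residue_surjective a
      rw [hθmk, Ideal.Quotient.eq, hm2, Ideal.mem_span_singleton] at ha
      have : ϖ ∣ ϖ * t - r := (dvd_pow_self ϖ two_ne_zero).trans ha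
      exact (dvd_sub_right (dvd_mul_right ϖ t)).1 this
  · obtain ⟨r, rfl⟩ := Ideal.Quotient.mk_surjective s
    obtain ⟨t, rfl⟩ := IsLocalRing.residue_surjective a
    rw [hρmk, ← map_mul, hθmk, hθmk, ← map_mul, mul_left_comm]

end ConjugacyClasses

/-! ### Application to local fields. -/

theorem IsNonarchimedeanLocalField.finite_reducedIntegers (F : Type*) [Field F] [ValuativeRel F]
    [TopologicalSpace F] [IsNonarchimedeanLocalField F] (l : ℕ) :
    Finite (ReducedIntegers F l) :=
  have : Finite (𝒪[F] ⧸ 𝓂[F]) := inferInstanceAs (Finite 𝓀[F])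
  Ideal.finite_quotient_pow (IsNoetherian.noetherian _) l

theorem mainTheorem5
    (F : Type*) [Field F] [ValuativeRel F] [TopologicalSpace F] [IsNonarchimedeanLocalField F]
    (F' : Type*) [Field F'] [ValuativeRel F'] [TopologicalSpace F'] [IsNonarchimedeanLocalField F']
    (hq : Nat.card 𝓀[F] = Nat.card 𝓀[F']) (n : ℕ) :
    Finite (ConjClasses (GL (Fin n) (ReducedIntegers F 2))) ∧
      Finite (ConjClasses (GL (Fin n) (ReducedIntegers F' 2))) ∧
      Nat.card (ConjClasses (GL (Fin n) (ReducedIntegers F 2))) =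
        Nat.card (ConjClasses (GL (Fin n) (ReducedIntegers F' 2))) := by
  have := IsNonarchimedeanLocalField.finite_reducedIntegers F 2
  have := IsNonarchimedeanLocalField.finite_reducedIntegers F' 2
  refine ⟨Quotient.finite _, Quotient.finite _, ?_⟩
  have := Fintype.ofFinite 𝓀[F]
  have := Fintype.ofFinite 𝓀[F']
  rw [Nat.card_eq_fintype_card, Nat.card_eq_fintype_card] at hq
  -- Finite fields of equal cardinality are isomorphic; through `σ` both rings become extensions of
  -- the single field `𝓀[F]`.
  let σ : 𝓀[F'] ≃+* 𝓀[F] := FiniteField.ringEquivOfCardEq hq.symm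
  obtain ⟨ρ, θ, _, hρ, hθ, hθρ, hθmul⟩ :=
    IsDiscreteValuationRing.exists_quotient_maximalIdeal_sq (R := 𝒪[F])
  obtain ⟨ρ', θ', _, hρ', hθ', hθρ', hθmul'⟩ :=
    IsDiscreteValuationRing.exists_quotient_maximalIdeal_sq (R := 𝒪[F'])
  have : IsLocalHom (σ : 𝓀[F'] →+* 𝓀[F]) := ⟨fun a h => by simpa using h.map σ.symm⟩
  obtain ⟨E⟩ := Matrix.GeneralLinearGroup.nonempty_conjClasses_equiv hρ θ hθ hθρ hθmul
    (ρ' := (σ : 𝓀[F'] →+* 𝓀[F]).comp ρ') (σ.surjective.comp hρ')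
    (θ'.comp (σ.symm : 𝓀[F] →+ 𝓀[F'])) (hθ'.comp σ.symm.injective)
    (fun s => by
      rw [RingHom.comp_apply, RingHom.coe_coe, map_eq_zero_iff σ σ.injective, hθρ']
      exact Set.ext_iff.1 (σ.symm.surjective.range_comp θ').symm s)
    (fun s a => by simp [hθmul']) n
  exact Nat.card_congr E
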